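/- **Theorem 3.4 (IRM-calc has feasible interpolation).** Consider prenex QBFs $$\mathcal F=\exists \vec p\,\mathcal Q\vec q\,\mathcal Q\vec r\,[A(\vec p,\vec q)\wedge B(\vec p,\vec r)],$$ where $\vec p,\vec q,\vec r$ are disjoint finite lists of distinct Boolean variables, $\vec q$ and $\vec r$ are quantified arbitrarily, $A$ is a CNF in the variables $\vec p,\vec q$, $B$ is a CNF in the variables $\vec p,\vec r$, and no clause contains a variable together with its negation. There are a computable procedure and a polynomial $P$ such that, for every such $\mathcal F$ (given with its parts $\vec p,\mathcal Q\vec q,\mathcal Q\vec r,A,B$) and every IRM-calc refutation $\pi$ of $\mathcal F$, the procedure outputs on input $(\mathcal F,\pi)$ a Boolean circuit $G$ (with constants, negations, and binary conjunctions and disjunctions) whose inputs are among $\vec p$, with at most $P(|\pi|)$ gates, where $|\pi|$ is the number of lines of $\pi$, such that for every $\vec a\in\{0,1\}^{\vec p}$ $$G(\vec a)=0\implies \mathcal Q\vec q.\,A(\vec a,\vec q)\text{ is false},\qquad G(\vec a)=1\implies \mathcal Q\vec r.\,B(\vec a,\vec r)\text{ is false}.$$ Here IRM-calc is the following system. An annotated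 clause is a finite set of annotated literals $l^{\sigma}$, with $l$ an existential literal and $\sigma$ a partial assignment of values $0,1,*$ to universal variables. Write $l^{[\sigma]}$ for $l$ annotated by the restriction of $\sigma$ to the variables quantified before the variable of $l$ (values $0,1,*$ are all kept), $\sigma\circ\tau$ for the assignment that is $\sigma$ on $\mathrm{dom}(\sigma)$ and $\tau$ on $\mathrm{dom}(\tau)\setminus\mathrm{dom}(\sigma)$, and $\mathrm{inst}(\tau,C)=\{l^{[\sigma\circ\tau]} : l^\sigma\in C\}$. The rules are: * Axiom: for a clause $C$ of the matrix, infer $\{l^{[\tau]} : l\in C \text{ existential}\}$, where $\tau$ is the assignment with domain the universal variables of $C$ that falsifies all universal literals of $C$. * Instantiation: from $C$ infer $\mathrm{inst}(\tau,C)$, where $\tau$ is a partial $\{0,1\}$-assignment to universal variables. * Resolution: from $x^{\tau\cup\xi}\vee C_1$ and $\neg x^{\tau\cup\sigma}\vee C_2$ infer $\mathrm{inst}(\sigma,C_1)\cup\mathrm{inst}(\xi,C_2)$, where $\mathrm{dom}(\tau),\mathrm{dom}(\xi),\mathrm{dom}(\sigma)$ are pairwise disjoint and $\tau$ has values in $\{0,1\}$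 only. * Merging: from $C\vee b^\mu\vee b^\sigma$ with $\mathrm{dom}(\mu)=\mathrm{dom}(\sigma)$ infer $C\vee b^\xi$, where $\mathrm{dom}(\xi)=\mathrm{dom}(\mu)$, $\xi(u)=\mu(u)$ if $\mu(u)=\sigma(u)$, and $\xi(u)=*$ otherwise. A refutation is a finite sequence of annotated clauses (lines) ending in the empty clause, each obtained by one of the rules from earlier lines and recorded together with the rule used, its parent lines, and its matrix clause or pivot variable. -/

import Mathlib

namespace IRMCalc

/-! ## Quantified Boolean formulas -/

/-- A literal is a variable (a natural number) with a sign: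
`(x, true)` is `x` and `(x, false)` is `¬ x`. -/
abbrev Literal := ℕ × Bool

/-- A clause, read as the set (disjunction) of its literals. -/
abbrev Clause := List Literal

/-- A formula in conjunctive normal form. -/
abbrev CNF := List Clause

/-- The two quantifiers. -/
inductive Quant
  | ex
  | all
  deriving DecidableEq

/-- A quantifier prefix, outermost quantifier first. -/
abbrev Prefix := List (Quant × ℕ)

/-- The variables of a prefix in the order of quantification. -/
def Prefix.vars (Q : Prefix) : List ℕ := Q.map Prod.snd

/-- The index of a variable is its position in the prefix; this is `ind u < ind x`. -/
def Prefix.Before (Q : Prefix) (u x : ℕ) : Prop := Q.vars.idxOf u < Q.vars.idxOf x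

/-- Satisfaction of a CNF by a total assignment. -/
def CNF.Sat (φ : CNF) (α : ℕ → Bool) : Prop := ∀ C ∈ φ, ∃ l ∈ C, α l.1 = l.2

/-- Truth of `Q. φ`, the free variables being evaluated by `α`. -/
def QTrue (φ : CNF) : Prefix → (ℕ → Bool) → Prop
  | [], α => φ.Sat α
  | (Quant.ex, x) :: Q, α => ∃ b, QTrue φ Q (Function.update α x b)
  | (Quant.all, x) :: Q, α => ∀ b, QTrue φ Q (Function.update α x b)

/-- A formula `∃ p. Q q. Q r. [A(p, q) ∧ B(p, r)]`, given with its parts. -/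
structure SplitQBF where
  p : List ℕ
  q : Prefix
  r : Prefix
  A : CNF
  B : CNF

/-- The whole quantifier prefix `∃ p. Q q. Q r`. -/
def SplitQBF.quants (F : SplitQBF) : Prefix :=
  F.p.map (fun x => (Quant.ex, x)) ++ F.q ++ F.r

/-- The whole matrix `A ∧ B`. -/
def SplitQBF.matrix (F : SplitQBF) : CNF := F.A ++ F.B

/-- The quantified variables are pairwise distinct (in particular `p`, `q`, `r` are disjoint),
`A` uses only variables of `p` and `q`, `B` uses only variables of `p` and `r`,
and no clause is tautological. -/
structure SplitQBF.WellFormed (F : SplitQBF) : Prop where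
  nodup : F.quants.vars.Nodup
  vars_A : ∀ C ∈ F.A, ∀ l ∈ C, l.1 ∈ F.p ∨ l.1 ∈ F.q.vars
  vars_B : ∀ C ∈ F.B, ∀ l ∈ C, l.1 ∈ F.p ∨ l.1 ∈ F.r.vars
  not_taut : ∀ C ∈ F.matrix, ∀ x, ¬ ((x, true) ∈ C ∧ (x, false) ∈ C)

/-! ## Annotated clauses -/

/-- The values that an annotation may give to a universal variable: `0`, `1` or `*`. -/
inductive Val
  | zero
  | one
  | star
  deriving DecidableEq

/-- An annotation: a partial assignment of `0`, `1`, `*`; `none` means not in the domain. -/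
abbrev Ann := ℕ → Option Val

/-- An annotated literal `l^σ`. -/
abbrev AnnLit := Literal × Ann

/-- An annotated clause is a set of annotated literals. -/
abbrev AnnClause := Set AnnLit

/-- The domain of a partial assignment. -/
def Ann.dom (σ : Ann) : Set ℕ := {u | σ u ≠ none}

/-- The range of the partial assignment is contained in `{0, 1}`. -/
def Ann.ZeroOne (σ : Ann) : Prop := ∀ u, σ u ≠ some Val.star

/-- The completion of `σ` by `τ`: follow `σ` on its domain and `τ` elsewhere. For disjoint
domains this is the union of the two assignments. -/
def Ann.complete (σ τ : Ann) : Ann := fun u => (σ u).or (τ u)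

open Classical in
/-- The annotated literal `l^[σ]`: keep only what `σ` assigns to variables quantified
before `l`. -/
noncomputable def restrictLit (Q : Prefix) (l : Literal) (σ : Ann) : AnnLit :=
  (l, fun u => if Q.Before u l.1 then σ u else none)

/-- `inst(τ, C)`, the set of all `l^[σ completed by τ]` for `l^σ ∈ C`. -/
def instantiate (Q : Prefix) (τ : Ann) (C : AnnClause) : AnnClause :=
  {m | ∃ l σ, (l, σ) ∈ C ∧ m = restrictLit Q l (Ann.complete σ τ)}

open Classical in
/-- The assignment that falsifies every universal literal of the clause `C`. -/
noncomputable def falsifier (Q : Prefix) (C : Clause) : Ann := fun u =>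
  if (Quant.all, u) ∈ Q ∧ (u, true) ∈ C then some Val.zero
  else if (Quant.all, u) ∈ Q ∧ (u, false) ∈ C then some Val.one
  else none

/-- The annotation obtained by merging `μ` and `σ`: common values are kept, different values
are merged to `*`. -/
def Ann.merge (μ σ : Ann) : Ann := fun u =>
  match μ u, σ u with
  | some c, some d => if c = d then some c else some Val.star
  | _, _ => none

/-! ## The rules of IRM-calc -/

/-- Axiom rule: the annotated clause obtained from the matrix clause `C`. -/
def axiomClause (Q : Prefix) (C : Clause) : AnnClause :=
  {m | ∃ l ∈ C, (Quant.ex, l.1) ∈ Q ∧ m = restrictLit Q l (falsifier Q C)}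

/-- Instantiation rule: `E` is inferred from `D`. -/
def InstRule (Q : Prefix) (D E : AnnClause) : Prop :=
  ∃ τ : Ann, (∀ u ∈ τ.dom, (Quant.all, u) ∈ Q) ∧ τ.ZeroOne ∧ E = instantiate Q τ D

/-- Resolution rule with pivot `x`: `E` is inferred from `D₁` and `D₂`. -/
def ResRule (Q : Prefix) (x : ℕ) (D₁ D₂ E : AnnClause) : Prop :=
  ∃ (τ ξ σ : Ann) (C₁ C₂ : AnnClause),
    Disjoint τ.dom ξ.dom ∧ Disjoint τ.dom σ.dom ∧ Disjoint ξ.dom σ.dom ∧ τ.ZeroOne ∧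
    D₁ = insert ((x, true), Ann.complete τ ξ) C₁ ∧
    D₂ = insert ((x, false), Ann.complete τ σ) C₂ ∧
    E = instantiate Q σ C₁ ∪ instantiate Q ξ C₂

/-- Merging rule: `E` is inferred from `D`. -/
def MergeRule (D E : AnnClause) : Prop :=
  ∃ (b : Literal) (μ σ : Ann) (C : AnnClause),
    μ.dom = σ.dom ∧ D = insert (b, μ) (insert (b, σ) C) ∧ E = insert (b, Ann.merge μ σ) C

/-! ## Proofs as finite objects -/

/-- The inference by which a line is obtained: an axiom from a matrix clause, an instantiation
of, or a merging in, the line with the given number, or a resolution of two lines (the first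
contains the positive pivot literal) on the given pivot variable. -/
inductive Inference
  | ax (C : Clause)
  | inst (i : ℕ)
  | res (i j x : ℕ)
  | merge (i : ℕ)

/-- An annotation written down as a finite list. -/
abbrev AnnCode := List (ℕ × Val)

/-- The partial assignment that is written down (the first entry of a variable counts). -/
def AnnCode.toAnn (s : AnnCode) : Ann := fun u => List.lookup u s

/-- A line of a proof: an annotated clause, written down as a list, and its inference. -/
structure Line where
  code : List (Literal × AnnCode)
  inference : Inference

/-- The annotated clause of a line. -/
def Line.clause (L : Line) : AnnClause := {m | ∃ c ∈ L.code, m = (c.1, AnnCode.toAnn c.2)}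

/-- A proof, i.e. a sequence of lines. -/
abbrev Proof := List Line

/-- The line `L` follows from the matrix `φ` and the lines `prev` before it. -/
def Line.Follows (Q : Prefix) (φ : CNF) (prev : List Line) (L : Line) : Prop :=
  match L.inference with
  | .ax C => C ∈ φ ∧ L.clause = axiomClause Q C
  | .inst i => ∃ P, prev[i]? = some P ∧ InstRule Q P.clause L.clause
  | .res i j x => ∃ P₁ P₂, prev[i]? = some P₁ ∧ prev[j]? = some P₂ ∧
      ResRule Q x P₁.clause P₂.clause L.clause
  | .merge i => ∃ P, prev[i]? = some P ∧ MergeRule P.clause L.clause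

/-- `π` is an IRM-calc refutation of `Q. φ`: every line follows from earlier ones, and the last
line is the empty clause. -/
def IsRefutation (Q : Prefix) (φ : CNF) (π : Proof) : Prop :=
  (∀ (k : ℕ) (L : Line), π[k]? = some L → L.Follows Q φ (π.take k)) ∧
  ∃ L : Line, π.getLast? = some L ∧ L.clause = ∅

/-- The size of a proof is the number of its lines. -/
def Proof.size (π : Proof) : ℕ := π.length

/-! ## Boolean circuits -/

/-- A gate; natural-number arguments of `not`, `and`, `or` are numbers of other gates. -/
inductive Gate
  | const (b : Bool)
  | input (x : ℕ)
  | not (i : ℕ)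
  | and (i j : ℕ)
  | or (i j : ℕ)

/-- A circuit: a topologically sorted sequence of gates, the last one is the output. -/
abbrev Circuit := List Gate

/-- The value of a gate, given the values of the earlier gates. -/
def Gate.eval (a : ℕ → Bool) (vals : List Bool) : Gate → Bool
  | .const b => b
  | .input x => a x
  | .not i => !(vals.getD i false)
  | .and i j => vals.getD i false && vals.getD j false
  | .or i j => vals.getD i false || vals.getD j false

/-- The values of all gates. -/
def Circuit.values (a : ℕ → Bool) (G : Circuit) : List Bool :=
  G.foldl (fun vals g => vals ++ [g.eval a vals]) []

/-- The value of the output gate. -/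
def Circuit.eval (G : Circuit) (a : ℕ → Bool) : Bool := (G.values a).getLastD false

/-- The gate with number `k` reads only gates with smaller numbers, and only inputs in `X`. -/
def Gate.Admissible (X : List ℕ) (k : ℕ) : Gate → Prop
  | .const _ => True
  | .input x => x ∈ X
  | .not i => i < k
  | .and i j => i < k ∧ j < k
  | .or i j => i < k ∧ j < k

/-- `G` is a circuit with input variables in `X`. -/
def Circuit.WellFormed (X : List ℕ) (G : Circuit) : Prop :=
  G ≠ [] ∧ ∀ (k : ℕ) (g : Gate), G[k]? = some g → g.Admissible X k

/-- The size of a circuit is the number of its gates, constants and inputs included. -/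
def Circuit.size (G : Circuit) : ℕ := G.length

/-- `G` is an interpolation circuit for `F`. -/
def IsInterpolationCircuit (F : SplitQBF) (G : Circuit) : Prop :=
  G.WellFormed F.p ∧
  ∀ a : ℕ → Bool,
    (G.eval a = false → ¬ QTrue F.A F.q a) ∧ (G.eval a = true → ¬ QTrue F.B F.r a)

/-! ## Codings of the finite objects, for the notion of a computable function -/

def Quant.equiv : Quant ≃ Bool where
  toFun | .ex => false | .all => true
  invFun | false => .ex | true => .all
  left_inv := by rintro (_ | _) <;> rfl
  right_inv := by rintro (_ | _) <;> rfl

instance : Primcodable Quant := Primcodable.ofEquiv Bool Quant.equiv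

def Val.equiv : Val ≃ Option Bool where
  toFun | .zero => some false | .one => some true | .star => none
  invFun | some false => .zero | some true => .one | none => .star
  left_inv := by rintro (_ | _ | _) <;> rfl
  right_inv := by rintro (_ | _ | _) <;> rfl

instance : Primcodable Val := Primcodable.ofEquiv (Option Bool) Val.equiv

def SplitQBF.equiv : SplitQBF ≃ List ℕ × Prefix × Prefix × CNF × CNF where
  toFun F := (F.p, F.q, F.r, F.A, F.B)
  invFun t := ⟨t.1, t.2.1, t.2.2.1, t.2.2.2.1, t.2.2.2.2⟩
  left_inv _ := rfl
  right_inv _ := rfl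

instance : Primcodable SplitQBF := Primcodable.ofEquiv _ SplitQBF.equiv

def Inference.equiv : Inference ≃ Clause ⊕ ℕ ⊕ (ℕ × ℕ × ℕ) ⊕ ℕ where
  toFun
    | .ax C => .inl C
    | .inst i => .inr (.inl i)
    | .res i j x => .inr (.inr (.inl (i, j, x)))
    | .merge i => .inr (.inr (.inr i))
  invFun
    | .inl C => .ax C
    | .inr (.inl i) => .inst i
    | .inr (.inr (.inl (i, j, x))) => .res i j x
    | .inr (.inr (.inr i)) => .merge i
  left_inv := by rintro (_ | _ | _ | _) <;> rfl
  right_inv := by rintro (_ | _ | ⟨_, _, _⟩ | _) <;> rfl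

instance : Primcodable Inference := Primcodable.ofEquiv _ Inference.equiv

def Line.equiv : Line ≃ List (Literal × AnnCode) × Inference where
  toFun L := (L.code, L.inference)
  invFun t := ⟨t.1, t.2⟩
  left_inv _ := rfl
  right_inv _ := rfl

instance : Primcodable Line := Primcodable.ofEquiv _ Line.equiv

def Gate.equiv : Gate ≃ Bool ⊕ ℕ ⊕ ℕ ⊕ (ℕ × ℕ) ⊕ (ℕ × ℕ) where
  toFun
    | .const b => .inl b
    | .input x => .inr (.inl x)
    | .not i => .inr (.inr (.inl i))
    | .and i j => .inr (.inr (.inr (.inl (i, j))))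
    | .or i j => .inr (.inr (.inr (.inr (i, j))))
  invFun
    | .inl b => .const b
    | .inr (.inl x) => .input x
    | .inr (.inr (.inl i)) => .not i
    | .inr (.inr (.inr (.inl (i, j)))) => .and i j
    | .inr (.inr (.inr (.inr (i, j)))) => .or i j
  left_inv := by rintro (_ | _ | _ | _ | _) <;> rfl
  right_inv := by rintro (_ | _ | _ | ⟨_, _⟩ | ⟨_, _⟩) <;> rfl

instance : Primcodable Gate := Primcodable.ofEquiv _ Gate.equiv

end IRMCalc

/-!
An annotated clause is read as a claim about the game in which the two players assign the variables
of a prefix in turn, the existential player trying to satisfy the matrix: the universal player can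
play so that the matrix is falsified unless the existential player at some point makes true a
literal of the clause whose annotation agrees with the universal moves made so far. Axioms are
valid in this sense, all rules preserve validity, and validity of the empty clause means that the
formula is false.

For the interpolation, the moves on `p` are prescribed by `a`, and every line is shown to be valid
for the game on `A` or for the game on `B`. A gate records which: on a pivot in `p` the game follows
`a`, so the line inherits the value of the premise whose pivot literal is false; a pivot outside
the prefix of one of the games is irrelevant there, so that either premise suffices in that game,
while the other game needs both. Thus the gate of a resolution on `q` is a disjunction, the one of
a resolution on `r` a conjunction, and the one of a resolution on `p` a selection.
-/

namespace IRMCalc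

/-! ### The refutation game -/

/-- The order on the values of an annotation at a variable in which `*` lies above `0` and `1`,
and an undefined value is comparable only to itself. -/
inductive StarLE : Option Val → Option Val → Prop
  | refl (v : Option Val) : StarLE v v
  | star (v : Val) : StarLE (some v) (some .star)

/-- A value of an annotation agrees with a move of the universal player. The move `some b` assigns
`b` to the variable; the move `none` leaves the value to the opponent, and only undefined
annotations agree with it. -/
inductive Agrees : Option Val → Option Bool → Prop
  | undef : Agrees none none
  | zero : Agrees (some .zero) (some false)
  | one : Agrees (some .one) (some true)
  | star (b : Bool) : Agrees (some .star) (some b)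

theorem exists_agrees (v : Option Val) : ∃ m, Agrees v m := by
  rcases v with _ | _ | _ | _
  exacts [⟨_, .undef⟩, ⟨_, .zero⟩, ⟨_, .one⟩, ⟨_, .star true⟩]

theorem Agrees.of_starLE {v w : Option Val} {m : Option Bool} (h : Agrees v m)
    (hvw : StarLE v w) : Agrees w m := by
  cases hvw with
  | refl => exact h
  | star => cases h <;> exact .star _

theorem Agrees.or {v w : Option Val} {m n : Option Bool} (h : Agrees v m)
    (hn : m = none → Agrees w n) : Agrees (v.or w) (m.or n) := by
  cases h with
  | undef => simpa only [Option.none_or] using hn rfl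
  | zero => exact .zero
  | one => exact .one
  | star b => exact .star b

theorem agrees_none_iff {v : Option Val} : Agrees v none ↔ v = none :=
  ⟨fun h => by cases h; rfl, fun h => h ▸ .undef⟩

theorem agrees_none_left_iff {m : Option Bool} : Agrees none m ↔ m = none :=
  ⟨fun h => by cases h; rfl, fun h => h ▸ .undef⟩

theorem Agrees.unique {v : Option Val} {m n : Option Bool} (hm : Agrees v m) (hn : Agrees v n)
    (hv : v ≠ some .star) : m = n := by
  cases hm <;> cases hn <;> first | rfl | exact absurd rfl hv

theorem Agrees.or_comm {t v w : Option Val} {m n : Option Bool} (hm : Agrees (t.or v) m)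
    (hn : Agrees (t.or w) n) (ht : t ≠ some .star) (hvw : v = none ∨ w = none) :
    m.or n = n.or m := by
  cases t with
  | some c => rw [hm.unique hn ht]
  | none =>
    rcases hvw with rfl | rfl
    · simp [agrees_none_left_iff.1 hm]
    · simp [agrees_none_left_iff.1 hn]

theorem Agrees.of_or_of_eq_none {t v w : Option Val} {m n : Option Bool}
    (hm : Agrees (t.or v) m) (hn : Agrees (t.or w) n) (hmn : m = none) : Agrees w n := by
  rw [hmn, agrees_none_iff, Option.or_eq_none_iff] at hm
  rwa [hm.1, Option.none_or] at hn

/-- The annotated literals of `C` that survive the universal move `m` on `u`. -/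
def AnnClause.select (C : AnnClause) (u : ℕ) (m : Option Bool) : AnnClause :=
  {l ∈ C | Agrees (l.2 u) m}

theorem AnnClause.select_empty (u : ℕ) (m : Option Bool) :
    AnnClause.select ∅ u m = ∅ := Set.sep_empty _

theorem AnnClause.select_insert {C : AnnClause} {l : AnnLit} {u : ℕ} {m : Option Bool}
    (h : Agrees (l.2 u) m) : AnnClause.select (insert l C) u m = insert l (C.select u m) :=
  Set.insert_inter_of_mem h

theorem AnnClause.select_insert_of_not_agrees {C : AnnClause} {l : AnnLit} {u : ℕ}
    {m : Option Bool} (h : ¬ Agrees (l.2 u) m) :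
    AnnClause.select (insert l C) u m = C.select u m :=
  Set.insert_inter_of_notMem h

/-- Validity of the annotated clause `C` for `Q. φ`: in the game in which the moves of the
existential player are restricted to the literals in `S`, the universal player can falsify `φ`
unless the existential player makes true a literal of `C` that survives the universal moves.
After a universal move `m`, the value `b` supplied by the opponent matters only if `m = none`. -/
def Valid (S : Set Literal) (φ : CNF) : Prefix → (ℕ → Bool) → AnnClause → Prop
  | [], α, _ => ¬ φ.Sat α
  | (.ex, x) :: Q, α, C =>
      ∀ b, (x, b) ∈ S → (∃ σ, ((x, b), σ) ∈ C) ∨ Valid S φ Q (Function.update α x b) C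
  | (.all, u) :: Q, α, C =>
      ∃ m : Option Bool, ∀ b, Valid S φ Q (Function.update α u (m.getD b)) (C.select u m)

theorem Valid.not_qTrue {S : Set Literal} {φ : CNF} {Q : Prefix} {α : ℕ → Bool}
    (h : Valid S φ Q α ∅) (hS : ∀ l : Literal, l.1 ∈ Q.vars → l ∈ S) : ¬ QTrue φ Q α := by
  induction Q generalizing α with
  | nil => exact h
  | cons y Q ih =>
    have ih {α} (h : Valid S φ Q α ∅) := ih h fun l hl => hS l (List.mem_cons_of_mem _ hl)
    obtain ⟨_ | _, x⟩ := y
    · rintro ⟨b, hb⟩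
      exact ih ((h b (hS _ List.mem_cons_self)).resolve_left (by simp)) hb
    · obtain ⟨m, h⟩ := h
      rw [AnnClause.select_empty] at h
      exact fun hq => ih (h true) (hq _)

theorem Prefix.mem_vars {Q : Prefix} {k : Quant} {x : ℕ} (h : (k, x) ∈ Q) : x ∈ Q.vars :=
  List.mem_map_of_mem (f := Prod.snd) h

theorem Prefix.nodup_tail {Q : Prefix} {y : Quant × ℕ} (hQ : (Prefix.vars (y :: Q)).Nodup) :
    Q.vars.Nodup := (List.nodup_cons.1 hQ).2

theorem Prefix.ne_of_nodup_cons {Q : Prefix} {y : Quant × ℕ} {x : ℕ}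
    (hQ : (Prefix.vars (y :: Q)).Nodup) (hx : x ∈ Q.vars) : x ≠ y.2 :=
  ne_of_mem_of_not_mem hx (List.nodup_cons.1 hQ).1

theorem Prefix.before_cons_iff {Q : Prefix} {y : Quant × ℕ} {u x : ℕ} (hx : x ≠ y.2) :
    Prefix.Before (y :: Q) u x ↔ u = y.2 ∨ Q.Before u x := by
  by_cases hu : u = y.2
  · simp [Prefix.Before, Prefix.vars, hu, List.idxOf_cons_ne _ hx.symm]
  · simp [Prefix.Before, Prefix.vars, hu, List.idxOf_cons_ne _ hx.symm,
      List.idxOf_cons_ne _ (Ne.symm hu)]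

theorem Prefix.not_before_head {Q : Prefix} {y : Quant × ℕ} {u : ℕ} :
    ¬ Prefix.Before (y :: Q) u y.2 := by
  simp [Prefix.Before, Prefix.vars]

theorem Prefix.Before.of_sublist {Q R : Prefix} (hQR : Q.Sublist R) (hR : R.vars.Nodup) {u x : ℕ}
    (hx : x ∈ Q.vars) (h : Q.Before u x) : R.Before u x := by
  induction hQR with
  | slnil => exact absurd hx List.not_mem_nil
  | cons y hQR ih =>
    have hne := Prefix.ne_of_nodup_cons hR ((hQR.map Prod.snd).subset hx)
    exact (Prefix.before_cons_iff hne).2 (.inr (ih (Prefix.nodup_tail hR) hx h))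
  | cons_cons y _ ih =>
    have hne : x ≠ y.2 := fun hxy => Prefix.not_before_head (hxy ▸ h)
    have hx : x ∈ Prefix.vars _ := (List.mem_cons.1 hx).resolve_left hne
    exact (Prefix.before_cons_iff hne).2
      (((Prefix.before_cons_iff hne).1 h).imp_right (ih (Prefix.nodup_tail hR) hx))

/-! ### Soundness of the rules -/

/-- Every literal of `C` that can be played in the game on `Q` occurs in `D`, where its annotation
is completed by `τ` and possibly weakened to `*`. Only annotations at variables quantified before
the literal are compared. -/
def Covers (S : Set Literal) (Q : Prefix) (τ : Ann) (C D : AnnClause) : Prop :=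
  ∀ l σ, (l, σ) ∈ C → l ∈ S → (Quant.ex, l.1) ∈ Q →
    ∃ ρ, (l, ρ) ∈ D ∧ ∀ u, Q.Before u l.1 → StarLE (Ann.complete σ τ u) (ρ u)

section Covers

variable {S : Set Literal} {Q : Prefix} {τ : Ann} {C D E : AnnClause} {l : AnnLit}

theorem Covers.tail {y : Quant × ℕ} (hQ : (Prefix.vars (y :: Q)).Nodup)
    (h : Covers S (y :: Q) τ C D) : Covers S Q τ C D := by
  intro l σ hl hS hx
  obtain ⟨ρ, hρ, h⟩ := h l σ hl hS (List.mem_cons_of_mem _ hx)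
  have hne := Prefix.ne_of_nodup_cons hQ (Prefix.mem_vars hx)
  exact ⟨ρ, hρ, fun u hu => h u ((Prefix.before_cons_iff hne).2 (.inr hu))⟩

theorem Covers.select {u : ℕ} {m n : Option Bool}
    (hQ : (Prefix.vars ((Quant.all, u) :: Q)).Nodup) (h : Covers S ((Quant.all, u) :: Q) τ C D)
    (hτ : m = none → Agrees (τ u) n) : Covers S Q τ (C.select u m) (D.select u (m.or n)) := by
  rintro l σ ⟨hl, hσ⟩ hS hx
  obtain ⟨ρ, hρ, h⟩ := h l σ hl hS (List.mem_cons_of_mem _ hx)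
  have hbefore {v} := Prefix.before_cons_iff (Q := Q) (u := v)
    (Prefix.ne_of_nodup_cons hQ (Prefix.mem_vars hx))
  exact ⟨ρ, ⟨hρ, (hσ.or hτ).of_starLE (h u (hbefore.2 (.inl rfl)))⟩,
    fun v hv => h v (hbefore.2 (.inr hv))⟩

theorem Covers.mono_right (h : Covers S Q τ C D) (hDE : D ⊆ E) : Covers S Q τ C E :=
  fun l σ hl hS hx => (h l σ hl hS hx).imp fun _ hρ => ⟨hDE hρ.1, hρ.2⟩

theorem Covers.insert_left (h : Covers S Q τ C D) (hl : (Quant.ex, l.1.1) ∈ Q → l.1 ∉ S) :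
    Covers S Q τ (insert l C) D := by
  rintro k σ (rfl | hk) hS hx
  · exact absurd hS (hl hx)
  · exact h k σ hk hS hx

theorem covers_instantiate {R : Prefix} (hQR : Q.Sublist R) (hR : R.vars.Nodup) (τ : Ann)
    (C : AnnClause) : Covers S Q τ C (instantiate R τ C) := by
  intro l σ hl _ hx
  refine ⟨_, ⟨l, σ, hl, rfl⟩, fun u hu => ?_⟩
  rw [if_pos (hu.of_sublist hQR hR (Prefix.mem_vars hx))]
  exact .refl _

theorem Ann.starLE_merge {μ σ : Ann} (h : μ.dom = σ.dom) (u : ℕ) :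
    StarLE (μ u) (Ann.merge μ σ u) ∧ StarLE (σ u) (Ann.merge μ σ u) := by
  have hdom : μ u ≠ none ↔ σ u ≠ none := Set.ext_iff.1 h u
  unfold Ann.merge
  rcases hμ : μ u with _ | c <;> rcases hσ : σ u with _ | d
  · exact ⟨.refl _, .refl _⟩
  · simp [hμ, hσ] at hdom
  · simp [hμ, hσ] at hdom
  · by_cases hcd : c = d
    · simpa [hcd] using StarLE.refl (some d)
    · simpa [hcd] using And.intro (StarLE.star c) (StarLE.star d)

theorem covers_merge {b : Literal} {μ σ : Ann} (h : μ.dom = σ.dom) :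
    Covers S Q (fun _ => none) (insert (b, μ) (insert (b, σ) C))
      (insert (b, Ann.merge μ σ) C) := by
  rintro l ρ hl - -
  simp only [Ann.complete, Option.or_none]
  rcases hl with ⟨⟨⟩⟩ | ⟨⟨⟩⟩ | hl
  · exact ⟨_, .inl rfl, fun u _ => (Ann.starLE_merge h u).1⟩
  · exact ⟨_, .inl rfl, fun u _ => (Ann.starLE_merge h u).2⟩
  · exact ⟨ρ, .inr hl, fun u _ => .refl _⟩

end Covers

section Valid

variable {S : Set Literal} {φ : CNF} {Q : Prefix} {α : ℕ → Bool} {C D E : AnnClause}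

theorem Valid.of_covers {τ : Ann} (hQ : Q.vars.Nodup) (h : Valid S φ Q α C)
    (hCD : Covers S Q τ C D) : Valid S φ Q α D := by
  induction Q generalizing α C D with
  | nil => exact h
  | cons y Q ih =>
    have hQ' := Prefix.nodup_tail hQ
    obtain ⟨_ | _, x⟩ := y
    · intro b hb
      rcases h b hb with ⟨σ, hσ⟩ | h
      · exact .inl ((hCD _ _ hσ hb List.mem_cons_self).imp fun _ => And.left)
      · exact .inr (ih hQ' h (hCD.tail hQ))
    · obtain ⟨m, h⟩ := h
      obtain ⟨n, hn⟩ := exists_agrees (τ x)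
      refine ⟨m.or n, fun b => ?_⟩
      rw [Option.getD_or]
      exact ih hQ' (h _) (hCD.select hQ fun _ => hn)

theorem Valid.resolve {x : ℕ} {τ ξ σ : Ann} {C₁ C₂ : AnnClause} (hQ : Q.vars.Nodup)
    (hξσ : Disjoint ξ.dom σ.dom) (hτ : τ.ZeroOne)
    (h₁ : Valid S φ Q α (insert ((x, true), Ann.complete τ ξ) C₁))
    (h₂ : Valid S φ Q α (insert ((x, false), Ann.complete τ σ) C₂))
    (hC₁ : Covers S Q σ C₁ E) (hC₂ : Covers S Q ξ C₂ E) : Valid S φ Q α E := by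
  induction Q generalizing α C₁ C₂ E with
  | nil => exact h₁
  | cons y Q ih =>
    have hQ' := Prefix.nodup_tail hQ
    obtain ⟨_ | _, y⟩ := y
    · intro b hb
      have notMem_tail {c} : (Quant.ex, y) ∈ Q → (y, c) ∉ S := fun hy =>
        absurd rfl (Prefix.ne_of_nodup_cons hQ (Prefix.mem_vars hy))
      -- A move that makes one pivot literal true leaves the other premise without its own.
      rcases h₁ b hb with ⟨ρ, ⟨⟨⟩⟩ | hρ⟩ | h₁
      · rcases h₂ true hb with ⟨ρ, ⟨⟨⟩⟩ | hρ⟩ | h₂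
        · exact .inl ((hC₂ _ _ hρ hb List.mem_cons_self).imp fun _ => And.left)
        · exact .inr (h₂.of_covers hQ' ((hC₂.tail hQ).insert_left notMem_tail))
      · exact .inl ((hC₁ _ _ hρ hb List.mem_cons_self).imp fun _ => And.left)
      · rcases h₂ b hb with ⟨ρ, ⟨⟨⟩⟩ | hρ⟩ | h₂
        · exact .inr (h₁.of_covers hQ' ((hC₁.tail hQ).insert_left notMem_tail))
        · exact .inl ((hC₂ _ _ hρ hb List.mem_cons_self).imp fun _ => And.left)
        · exact .inr (ih hQ' h₁ h₂ (hC₁.tail hQ) (hC₂.tail hQ))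
    · obtain ⟨m₁, h₁⟩ := h₁
      obtain ⟨m₂, h₂⟩ := h₂
      -- A premise whose pivot literal does not survive its move suffices on its own.
      by_cases hm₁ : Agrees (Ann.complete τ ξ y) m₁
      swap
      · rw [AnnClause.select_insert_of_not_agrees hm₁] at h₁
        exact Valid.of_covers hQ ⟨m₁, h₁⟩ hC₁
      by_cases hm₂ : Agrees (Ann.complete τ σ y) m₂
      swap
      · rw [AnnClause.select_insert_of_not_agrees hm₂] at h₂
        exact Valid.of_covers hQ ⟨m₂, h₂⟩ hC₂
      rw [AnnClause.select_insert hm₁] at h₁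
      rw [AnnClause.select_insert hm₂] at h₂
      have hy : ξ y = none ∨ σ y = none := by
        by_contra! h
        exact Set.disjoint_left.1 hξσ h.1 h.2
      have hcomm : m₁.or m₂ = m₂.or m₁ := hm₁.or_comm hm₂ (hτ y) hy
      have hE₁ := hC₁.select hQ (hm₁.of_or_of_eq_none hm₂)
      have hE₂ := hC₂.select hQ (hm₂.of_or_of_eq_none hm₁)
      refine ⟨m₁.or m₂, fun b => ih hQ' ?_ ?_ hE₁ (hcomm ▸ hE₂)⟩
      · simpa only [Option.getD_or] using h₁ (m₂.getD b)
      · simpa only [hcomm, Option.getD_or] using h₂ (m₁.getD b)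

theorem Valid.of_mem {C : Clause} {τ : Ann} (hC : C ∈ φ)
    (hτ : ∀ u, (Quant.all, u) ∈ Q → ∃ m, Agrees (τ u) m ∧ ∀ b, (u, m.getD b) ∉ C)
    (hα : ∀ l ∈ C, l.1 ∉ Q.vars → α l.1 ≠ l.2) : Valid S φ Q α {l | l.1 ∈ C ∧ l.2 = τ} := by
  induction Q generalizing α with
  | nil =>
    intro h
    obtain ⟨l, hl, hαl⟩ := h C hC
    exact hα l hl List.not_mem_nil hαl
  | cons y Q ih =>
    have ih {b} (hb : (y.2, b) ∉ C) :
        Valid S φ Q (Function.update α y.2 b) {l | l.1 ∈ C ∧ l.2 = τ} := by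
      refine ih (fun u hu => hτ u (List.mem_cons_of_mem _ hu)) fun l hl hlQ => ?_
      by_cases hly : l.1 = y.2
      · rw [hly, Function.update_self]
        rintro rfl
        exact hb (hly ▸ hl)
      · rw [Function.update_of_ne hly]
        exact hα l hl fun h => (List.mem_cons.1 h).elim hly hlQ
    obtain ⟨_ | _, y⟩ := y
    · intro b _
      by_cases hb : (y, b) ∈ C
      · exact .inl ⟨τ, hb, rfl⟩
      · exact .inr (ih hb)
    · obtain ⟨m, hm, hmC⟩ := hτ y List.mem_cons_self
      have hselect : AnnClause.select {l | l.1 ∈ C ∧ l.2 = τ} y m = {l | l.1 ∈ C ∧ l.2 = τ} :=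
        Set.sep_eq_self_iff_mem_true.2 fun l hl => hl.2 ▸ hm
      refine ⟨m, fun b => ?_⟩
      rw [hselect]
      exact ih (hmC b)

theorem exists_agrees_falsifier {R : Prefix} {C : Clause} {u : ℕ} (hu : (Quant.all, u) ∈ R)
    (hC : ¬ ((u, true) ∈ C ∧ (u, false) ∈ C)) :
    ∃ m, Agrees (falsifier R C u) m ∧ ∀ b, (u, m.getD b) ∉ C := by
  by_cases ht : (u, true) ∈ C
  · exact ⟨some false, by simpa [falsifier, hu, ht] using Agrees.zero, fun _ h => hC ⟨ht, h⟩⟩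
  by_cases hf : (u, false) ∈ C
  · exact ⟨some true, by simpa [falsifier, hu, ht, hf] using Agrees.one, fun _ => ht⟩
  · refine ⟨none, by simpa [falsifier, ht, hf] using Agrees.undef, ?_⟩
    rintro (_ | _)
    exacts [hf, ht]

theorem valid_axiomClause {R : Prefix} (hQR : Q.Sublist R) (hR : R.vars.Nodup)
    {C : Clause} (hC : C ∈ φ)
    (hnt : ∀ u, (Quant.all, u) ∈ Q → ¬ ((u, true) ∈ C ∧ (u, false) ∈ C))
    (hvars : ∀ l ∈ C, l.1 ∈ Q.vars) : Valid S φ Q α (axiomClause R C) := by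
  have hvalid : Valid S φ Q α {l | l.1 ∈ C ∧ l.2 = falsifier R C} :=
    .of_mem hC (fun u hu => exists_agrees_falsifier (hQR.subset hu) (hnt u hu))
      fun l hl hlQ => absurd (hvars l hl) hlQ
  refine hvalid.of_covers (τ := fun _ => none) (hR.sublist (hQR.map _)) ?_
  rintro l σ ⟨hl, rfl⟩ - hx
  refine ⟨_, ⟨l, hl, hQR.subset hx, rfl⟩, fun u hu => ?_⟩
  rw [if_pos (hu.of_sublist hQR hR (Prefix.mem_vars hx)), Ann.complete, Option.or_none]
  exact .refl _

theorem Valid.instRule {R : Prefix} (hQR : Q.Sublist R) (hR : R.vars.Nodup)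
    (h : Valid S φ Q α D) (hE : InstRule R D E) : Valid S φ Q α E := by
  obtain ⟨τ, -, -, rfl⟩ := hE
  exact h.of_covers (hR.sublist (hQR.map _)) (covers_instantiate hQR hR τ D)

theorem Valid.mergeRule (hQ : Q.vars.Nodup) (h : Valid S φ Q α D) (hE : MergeRule D E) :
    Valid S φ Q α E := by
  obtain ⟨b, μ, σ, C, hdom, rfl, rfl⟩ := hE
  exact h.of_covers hQ (covers_merge hdom)

theorem Valid.resRule {R : Prefix} (hQR : Q.Sublist R) (hR : R.vars.Nodup)
    {x : ℕ} {D₁ D₂ : AnnClause} (h₁ : Valid S φ Q α D₁)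
    (h₂ : Valid S φ Q α D₂) (hE : ResRule R x D₁ D₂ E) : Valid S φ Q α E := by
  obtain ⟨τ, ξ, σ, C₁, C₂, -, -, hξσ, hτ, rfl, rfl, rfl⟩ := hE
  exact .resolve (hR.sublist (hQR.map _)) hξσ hτ h₁ h₂
    ((covers_instantiate hQR hR σ C₁).mono_right Set.subset_union_left)
    ((covers_instantiate hQR hR ξ C₂).mono_right Set.subset_union_right)

theorem Valid.resRule_left {R : Prefix} (hQR : Q.Sublist R) (hR : R.vars.Nodup)
    {x : ℕ} {D₁ D₂ : AnnClause} (h : Valid S φ Q α D₁) (hE : ResRule R x D₁ D₂ E)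
    (hx : (Quant.ex, x) ∈ Q → (x, true) ∉ S) : Valid S φ Q α E := by
  obtain ⟨τ, ξ, σ, C₁, C₂, -, -, -, -, rfl, rfl, rfl⟩ := hE
  exact h.of_covers (hR.sublist (hQR.map _)) <|
    ((covers_instantiate hQR hR σ C₁).mono_right Set.subset_union_left).insert_left hx

theorem Valid.resRule_right {R : Prefix} (hQR : Q.Sublist R) (hR : R.vars.Nodup)
    {x : ℕ} {D₁ D₂ : AnnClause} (h : Valid S φ Q α D₂) (hE : ResRule R x D₁ D₂ E)
    (hx : (Quant.ex, x) ∈ Q → (x, false) ∉ S) : Valid S φ Q α E := by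
  obtain ⟨τ, ξ, σ, C₁, C₂, -, -, -, -, rfl, rfl, rfl⟩ := hE
  exact h.of_covers (hR.sublist (hQR.map _)) <|
    ((covers_instantiate hQR hR ξ C₂).mono_right Set.subset_union_right).insert_left hx

end Valid

/-! ### The games on the two parts of the matrix -/

/-- The part of the matrix refuted when the interpolant has the given value: `A` for `false` and
`B` for `true`. -/
def SplitQBF.part (F : SplitQBF) : Bool → CNF
  | false => F.A
  | true => F.B

/-- The quantifiers below `p` of the part of the matrix with the given value of the interpolant. -/
def SplitQBF.block (F : SplitQBF) : Bool → Prefix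
  | false => F.q
  | true => F.r

/-- The quantifier prefix of one part of the matrix. -/
def SplitQBF.partPrefix (F : SplitQBF) (g : Bool) : Prefix :=
  F.p.map (fun x => (Quant.ex, x)) ++ F.block g

/-- The literals the existential player may play when the values of the variables in `p` are
prescribed by `a`. -/
def SplitQBF.moves (F : SplitQBF) (a : ℕ → Bool) : Set Literal :=
  {l | l.1 ∈ F.p → a l.1 = l.2}

/-- The annotated clause `C` is valid under `a` for the game on the part of `F` selected by `g`:
the value `g` of the gate of a line records which of the two games its clause refers to. -/
def Interpolates (F : SplitQBF) (a : ℕ → Bool) (C : AnnClause) (g : Bool) : Prop :=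
  Valid (F.moves a) (F.part g) (F.partPrefix g) a C

section Interpolates

variable {F : SplitQBF} {a : ℕ → Bool}

theorem SplitQBF.partPrefix_sublist (F : SplitQBF) (g : Bool) :
    (F.partPrefix g).Sublist F.quants := by
  cases g with
  | false => exact List.sublist_append_left _ _
  | true => exact (List.sublist_append_left _ _).append_right _

theorem SplitQBF.mem_vars_partPrefix {g : Bool} {x : ℕ} :
    x ∈ (F.partPrefix g).vars ↔ x ∈ F.p ∨ x ∈ (F.block g).vars := by
  simp [SplitQBF.partPrefix, Prefix.vars]

theorem SplitQBF.mem_part_of_mem_matrix {C : Clause} (hC : C ∈ F.matrix) :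
    C ∈ F.part (!decide (C ∈ F.A)) := by
  by_cases hA : C ∈ F.A
  · simp [SplitQBF.part, hA]
  · simpa [SplitQBF.part, hA] using (List.mem_append.1 hC).resolve_left hA

theorem SplitQBF.WellFormed.nodup_partPrefix (hF : F.WellFormed) (g : Bool) :
    (F.partPrefix g).vars.Nodup :=
  hF.nodup.sublist ((F.partPrefix_sublist g).map _)

theorem SplitQBF.WellFormed.mem_vars_partPrefix (hF : F.WellFormed) {g : Bool} {C : Clause}
    (hC : C ∈ F.part g) {l : Literal} (hl : l ∈ C) : l.1 ∈ (F.partPrefix g).vars := by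
  rw [SplitQBF.mem_vars_partPrefix]
  cases g with
  | false => exact hF.vars_A C hC l hl
  | true => exact hF.vars_B C hC l hl

theorem SplitQBF.WellFormed.notMem_vars_block (hF : F.WellFormed) {g : Bool} {x : ℕ}
    (hx : x ∈ F.p) : x ∉ (F.block g).vars := by
  have h := hF.nodup_partPrefix g
  rw [SplitQBF.partPrefix, Prefix.vars, List.map_append] at h
  exact fun hxg => (List.nodup_append.1 h).2.2 x (by simpa using hx) x hxg rfl

theorem SplitQBF.WellFormed.notMem_vars_r (hF : F.WellFormed) {x : ℕ} (hx : x ∈ F.q.vars) :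
    x ∉ F.r.vars := by
  have h := hF.nodup
  rw [SplitQBF.quants, Prefix.vars, List.map_append, List.map_append] at h
  exact fun hxr => (List.nodup_append.1 h).2.2 x (List.mem_append_right _ hx) x hxr rfl

theorem Valid.of_append_map_ex {S : Set Literal} {φ : CNF} {p : List ℕ} {Q : Prefix}
    (h : Valid S φ (p.map (fun x => (Quant.ex, x)) ++ Q) a ∅) (hS : ∀ x ∈ p, (x, a x) ∈ S) :
    Valid S φ Q a ∅ := by
  induction p with
  | nil => exact h
  | cons x p ih =>
    rw [List.forall_mem_cons] at hS
    have h := (h (a x) hS.1).resolve_left (by simp)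
    rw [Function.update_eq_self] at h
    exact ih h hS.2

theorem Interpolates.not_qTrue {g : Bool} (hF : F.WellFormed) (h : Interpolates F a ∅ g) :
    ¬ QTrue (F.part g) (F.block g) a :=
  (Valid.of_append_map_ex h fun _ _ _ => rfl).not_qTrue fun _ hl hp =>
    absurd hl (hF.notMem_vars_block hp)

theorem interpolates_axiomClause (hF : F.WellFormed) {C : Clause} (hC : C ∈ F.matrix) :
    Interpolates F a (axiomClause F.quants C) (!decide (C ∈ F.A)) :=
  have hmem := SplitQBF.mem_part_of_mem_matrix hC
  valid_axiomClause (F.partPrefix_sublist _) hF.nodup hmem (fun u _ => hF.not_taut C hC u)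
    fun _ => hF.mem_vars_partPrefix hmem

theorem Interpolates.resRule {x : ℕ} {D₁ D₂ E : AnnClause} {g : Bool} (hF : F.WellFormed)
    (h₁ : Interpolates F a D₁ g) (h₂ : Interpolates F a D₂ g)
    (hE : ResRule F.quants x D₁ D₂ E) : Interpolates F a E g :=
  Valid.resRule (F.partPrefix_sublist g) hF.nodup h₁ h₂ hE

theorem Interpolates.resRule_of_mem {x : ℕ} {D₁ D₂ E : AnnClause} {g h : Bool}
    (hF : F.WellFormed) (h₁ : Interpolates F a D₁ g) (h₂ : Interpolates F a D₂ h)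
    (hE : ResRule F.quants x D₁ D₂ E) (hx : x ∈ F.p) :
    Interpolates F a E (bif a x then h else g) := by
  cases hax : a x with
  | false =>
    refine h₁.resRule_left (F.partPrefix_sublist g) hF.nodup hE fun _ hS => ?_
    exact Bool.false_ne_true (hax ▸ hS hx)
  | true =>
    refine h₂.resRule_right (F.partPrefix_sublist h) hF.nodup hE fun _ hS => ?_
    exact Bool.false_ne_true (hax ▸ hS hx).symm

/-- In the game on the part `c`, which does not involve the pivot, either premise suffices; the
other game needs both. -/
theorem Interpolates.resRule_of_notMem {x : ℕ} {D₁ D₂ E : AnnClause} {c g h : Bool}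
    (hF : F.WellFormed) (h₁ : Interpolates F a D₁ g) (h₂ : Interpolates F a D₂ h)
    (hE : ResRule F.quants x D₁ D₂ E) (hx : x ∉ (F.partPrefix c).vars) :
    Interpolates F a E (bif c then g || h else g && h) := by
  have hx : (Quant.ex, x) ∉ F.partPrefix c := fun hmem => hx (Prefix.mem_vars hmem)
  have of_left (hg : g = c) : Interpolates F a E c :=
    (hg ▸ h₁).resRule_left (F.partPrefix_sublist c) hF.nodup hE fun hmem => absurd hmem hx
  have of_right (hh : h = c) : Interpolates F a E c :=
    (hh ▸ h₂).resRule_right (F.partPrefix_sublist c) hF.nodup hE fun hmem => absurd hmem hx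
  have of_both (hgh : g = h) : Interpolates F a E h := (hgh ▸ h₁).resRule hF h₂ hE
  cases c <;> cases g <;> cases h <;>
    first | exact of_left rfl | exact of_right rfl | exact of_both rfl

/-- The value of the gate of a line, given the values `v` of the gates of the earlier lines. -/
def Inference.value (F : SplitQBF) (a : ℕ → Bool) (v : ℕ → Bool) : Inference → Bool
  | .ax C => !decide (C ∈ F.A)
  | .inst i => v i
  | .merge i => v i
  | .res i j x =>
      if x ∈ F.p then bif a x then v j else v i
      else if x ∈ F.q.vars then v i || v j else v i && v j

theorem Line.Follows.interpolates {prev : List Line} {L : Line} {v : ℕ → Bool}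
    (hF : F.WellFormed) (hL : L.Follows F.quants F.matrix prev)
    (hv : ∀ i P, prev[i]? = some P → Interpolates F a P.clause (v i)) :
    Interpolates F a L.clause (L.inference.value F a v) := by
  unfold Line.Follows at hL
  cases hI : L.inference with
  | ax C =>
    obtain ⟨hC, hclause⟩ := hI ▸ hL
    exact hclause ▸ interpolates_axiomClause hF hC
  | inst i =>
    obtain ⟨P, hP, hrule⟩ := hI ▸ hL
    exact Valid.instRule (F.partPrefix_sublist _) hF.nodup (hv i P hP) hrule
  | merge i =>
    obtain ⟨P, hP, hrule⟩ := hI ▸ hL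
    exact Valid.mergeRule (hF.nodup_partPrefix _) (hv i P hP) hrule
  | res i j x =>
    obtain ⟨P₁, P₂, hP₁, hP₂, hrule⟩ := hI ▸ hL
    have h₁ := hv i P₁ hP₁
    have h₂ := hv j P₂ hP₂
    by_cases hxp : x ∈ F.p
    · rw [Inference.value, if_pos hxp]
      exact h₁.resRule_of_mem hF h₂ hrule hxp
    by_cases hxq : x ∈ F.q.vars
    · have hx : x ∉ (F.partPrefix true).vars := fun h =>
        (SplitQBF.mem_vars_partPrefix.1 h).elim hxp (hF.notMem_vars_r hxq)
      rw [Inference.value, if_neg hxp, if_pos hxq]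
      exact h₁.resRule_of_notMem hF h₂ hrule hx
    · have hx : x ∉ (F.partPrefix false).vars := fun h =>
        (SplitQBF.mem_vars_partPrefix.1 h).elim hxp hxq
      rw [Inference.value, if_neg hxp, if_neg hxq]
      exact h₁.resRule_of_notMem hF h₂ hrule hx

end Interpolates

/-! ### Circuits -/

theorem forall_getElem?_append_singleton_iff {β : Type*} {l : List β} {b : β}
    {P : ℕ → β → Prop} :
    (∀ k c, (l ++ [b])[k]? = some c → P k c) ↔
      (∀ k c, l[k]? = some c → P k c) ∧ P l.length b := by
  refine ⟨fun h => ⟨fun k c hc => h k c ?_, h _ b List.getElem?_concat_length⟩, ?_⟩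
  · rwa [List.getElem?_append_left (List.getElem?_eq_some_iff.1 hc).1]
  · rintro ⟨h, hb⟩ k c hc
    rcases lt_trichotomy k l.length with hk | rfl | hk
    · exact h k c (by rwa [List.getElem?_append_left hk] at hc)
    · rw [List.getElem?_concat_length, Option.some_inj] at hc
      exact hc ▸ hb
    · rw [List.getElem?_eq_none (by simpa using hk)] at hc
      cases hc

/-- The value of the gate with number `k`. -/
def Circuit.gateValue (a : ℕ → Bool) (G : Circuit) (k : ℕ) : Bool :=
  (G.values a).getD k false

theorem Gate.eval_not {a : ℕ → Bool} {G : Circuit} (i : ℕ) :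
    (Gate.not i).eval a (G.values a) = !G.gateValue a i := rfl

theorem Gate.eval_and {a : ℕ → Bool} {G : Circuit} (i j : ℕ) :
    (Gate.and i j).eval a (G.values a) = (G.gateValue a i && G.gateValue a j) := rfl

theorem Gate.eval_or {a : ℕ → Bool} {G : Circuit} (i j : ℕ) :
    (Gate.or i j).eval a (G.values a) = (G.gateValue a i || G.gateValue a j) := rfl

namespace Circuit

/-- Every gate reads only earlier gates and inputs in `X`. -/
def Admissible (X : List ℕ) (G : Circuit) : Prop :=
  ∀ (k : ℕ) (g : Gate), G[k]? = some g → g.Admissible X k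

variable {X : List ℕ} {a : ℕ → Bool} {G H : Circuit} {s : Gate} {t e k : ℕ}

theorem values_append_singleton (g : Gate) :
    Circuit.values a (G ++ [g]) = G.values a ++ [g.eval a (G.values a)] := by
  simp only [values, List.foldl_append, List.foldl_cons, List.foldl_nil]

theorem length_values : (G.values a).length = G.length := by
  induction G using List.reverseRecOn with
  | nil => rfl
  | append_singleton G g ih => simp [values_append_singleton, ih]

theorem eval_eq_gateValue : G.eval a = G.gateValue a (G.length - 1) := by
  rw [eval, gateValue, List.getLastD_eq_getLast?, List.getLast?_eq_getElem?,
    List.getD_eq_getElem?_getD, length_values]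

theorem gateValue_append_singleton (g : Gate) (k : ℕ) :
    Circuit.gateValue a (G ++ [g]) k =
      if k = G.length then g.eval a (G.values a) else G.gateValue a k := by
  rw [gateValue, values_append_singleton, ← length_values (a := a)]
  split_ifs with hk
  · simp [hk]
  rcases lt_or_gt_of_ne hk with hk | hk
  · exact List.getD_append _ _ _ _ hk
  · rw [gateValue, List.getD_eq_default _ _ hk.le, List.getD_eq_default _ _ (by simpa using hk)]

theorem gateValue_append_left (hk : k < G.length) :
    Circuit.gateValue a (G ++ H) k = G.gateValue a k := by
  induction H using List.reverseRecOn with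
  | nil => rw [List.append_nil]
  | append_singleton H g ih =>
    rw [← ih, ← List.append_assoc, gateValue_append_singleton, if_neg]
    rw [List.length_append]
    omega

theorem admissible_nil : Circuit.Admissible X [] := fun k g h => by simp at h

theorem admissible_append_singleton_iff {g : Gate} :
    Circuit.Admissible X (G ++ [g]) ↔ G.Admissible X ∧ g.Admissible X G.length :=
  forall_getElem?_append_singleton_iff

/-- Five gates, the first of which has the number `n`, that select the value of the gate `t` or of
the gate `e` according to the value of the selector `s`. With `t = e = n` they pass on the value of
`s` itself. -/
def selectGates (n : ℕ) (s : Gate) (t e : ℕ) : List Gate :=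
  [s, .not n, .and n t, .and (n + 1) e, .or (n + 2) (n + 3)]

theorem length_selectGates {n : ℕ} : (selectGates n s t e).length = 5 := rfl

theorem append_selectGates (G : Circuit) (n : ℕ) (s : Gate) (t e : ℕ) :
    G ++ selectGates n s t e =
      G ++ [s] ++ [.not n] ++ [.and n t] ++ [.and (n + 1) e] ++ [.or (n + 2) (n + 3)] := by
  simp [selectGates]

theorem admissible_append_selectGates (hG : G.Admissible X) (hs : s.Admissible X G.length)
    (ht : t ≤ G.length) (he : e ≤ G.length) :
    Circuit.Admissible X (G ++ selectGates G.length s t e) := by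
  simp only [append_selectGates, admissible_append_singleton_iff, Gate.Admissible,
    List.length_append, List.length_singleton]
  exact ⟨⟨⟨⟨⟨hG, hs⟩, by omega⟩, by omega⟩, by omega⟩, by omega⟩

theorem gateValue_append_selectGates (ht : t ≤ G.length) (he : e ≤ G.length) :
    Circuit.gateValue a (G ++ selectGates G.length s t e) (G.length + 4) =
      bif s.eval a (G.values a) then Circuit.gateValue a (G ++ [s]) t
      else Circuit.gateValue a (G ++ [s]) e := by
  have ht₁ : t ≠ G.length + 1 := by omega
  have he₁ : e ≠ G.length + 1 := by omega
  have he₂ : e ≠ G.length + 1 + 1 := by omega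
  simp only [append_selectGates, gateValue_append_singleton, Gate.eval_and,
    Gate.eval_or, Gate.eval_not, List.length_append, List.length_singleton]
  cases hs : s.eval a (G.values a) <;> simp [ht₁, he₁, he₂]

end Circuit

/-! ### Extraction of the circuit -/

/-- The number of the gate that computes the value of the line with number `i`. -/
def outputGate (i : ℕ) : ℕ := 5 * i + 4

/-- The numbers of the premises of an inference. -/
def Inference.premises : Inference → List ℕ
  | .ax _ => []
  | .inst i => [i]
  | .res i j _ => [i, j]
  | .merge i => [i]

/-- The selector and the two candidates, to be passed to `Circuit.selectGates n`, that compute the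
value of an inference. -/
def Inference.selection (F : SplitQBF) (n : ℕ) : Inference → Gate × ℕ × ℕ
  | .ax C => (.const !decide (C ∈ F.A), n, n)
  | .inst i => (.const true, outputGate i, outputGate i)
  | .merge i => (.const true, outputGate i, outputGate i)
  | .res i j x =>
      if x ∈ F.p then (.input x, outputGate j, outputGate i)
      else if x ∈ F.q.vars then (.or (outputGate i) (outputGate j), n, n)
      else (.and (outputGate i) (outputGate j), n, n)

/-- The gates with numbers `n`, …, `n + 4` that compute the value of an inference. -/
def Inference.gates (F : SplitQBF) (n : ℕ) (I : Inference) : List Gate :=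
  Circuit.selectGates n (I.selection F n).1 (I.selection F n).2.1 (I.selection F n).2.2

/-- The interpolation circuit read off a proof, with five gates for every line. -/
def extractCircuit (F : SplitQBF) (π : Proof) : Circuit :=
  π.foldl (fun G L => G ++ L.inference.gates F G.length) []

section Extraction

variable {F : SplitQBF} {Q : Prefix} {φ : CNF} {π : Proof} {L : Line} {G : Circuit}
  {a : ℕ → Bool}

theorem Line.Follows.premises_lt (h : L.Follows Q φ π) :
    ∀ i ∈ L.inference.premises, i < π.length := by
  have lt_of_getElem? {i : ℕ} {P : Line} (hP : π[i]? = some P) : i < π.length :=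
    (List.getElem?_eq_some_iff.1 hP).1
  unfold Line.Follows at h
  cases hI : L.inference with
  | ax C => simp [Inference.premises]
  | inst i =>
    obtain ⟨P, hP, -⟩ := hI ▸ h
    simpa [Inference.premises] using lt_of_getElem? hP
  | merge i =>
    obtain ⟨P, hP, -⟩ := hI ▸ h
    simpa [Inference.premises] using lt_of_getElem? hP
  | res i j x =>
    obtain ⟨P₁, P₂, hP₁, hP₂, -⟩ := hI ▸ h
    simpa [Inference.premises] using ⟨lt_of_getElem? hP₁, lt_of_getElem? hP₂⟩

theorem Inference.admissible_selection {I : Inference} {n : ℕ}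
    (h : ∀ i ∈ I.premises, outputGate i < n) :
    (I.selection F n).1.Admissible F.p n ∧ (I.selection F n).2.1 ≤ n ∧
      (I.selection F n).2.2 ≤ n := by
  cases I with
  | ax C => exact ⟨trivial, le_rfl, le_rfl⟩
  | inst i | merge i =>
    have hi := h i List.mem_cons_self
    exact ⟨trivial, hi.le, hi.le⟩
  | res i j x =>
    have hi := h i List.mem_cons_self
    have hj := h j (List.mem_cons_of_mem _ List.mem_cons_self)
    simp only [Inference.selection]
    split_ifs with hxp
    exacts [⟨hxp, hj.le, hi.le⟩, ⟨⟨hi, hj⟩, le_rfl, le_rfl⟩, ⟨⟨hi, hj⟩, le_rfl, le_rfl⟩]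

theorem Inference.gateValue_append_gates {I : Inference}
    (h : ∀ i ∈ I.premises, outputGate i < G.length) :
    Circuit.gateValue a (G ++ I.gates F G.length) (G.length + 4) =
      I.value F a fun i => G.gateValue a (outputGate i) := by
  obtain ⟨-, ht, he⟩ := Inference.admissible_selection (F := F) h
  rw [Inference.gates, Circuit.gateValue_append_selectGates ht he]
  cases I with
  | ax C => simp [Inference.selection, Inference.value, Circuit.gateValue_append_singleton,
      Gate.eval]
  | inst i | merge i =>
    have hi := h i List.mem_cons_self
    simp [Inference.selection, Inference.value, Circuit.gateValue_append_left hi, Gate.eval]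
  | res i j x =>
    have hi := h i List.mem_cons_self
    have hj := h j (List.mem_cons_of_mem _ List.mem_cons_self)
    simp only [Inference.selection, Inference.value]
    split_ifs
    · simp [Circuit.gateValue_append_left hi, Circuit.gateValue_append_left hj, Gate.eval]
    all_goals simp [Circuit.gateValue_append_singleton, Gate.eval_or, Gate.eval_and]

theorem extractCircuit_append_singleton :
    extractCircuit F (π ++ [L]) =
      extractCircuit F π ++ L.inference.gates F (extractCircuit F π).length := by
  simp only [extractCircuit, List.foldl_append, List.foldl_cons, List.foldl_nil]

theorem length_extractCircuit : (extractCircuit F π).length = 5 * π.length := by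
  induction π using List.reverseRecOn with
  | nil => rfl
  | append_singleton π L ih =>
    rw [extractCircuit_append_singleton, List.length_append, ih, Inference.gates,
      Circuit.length_selectGates, List.length_append, List.length_singleton, mul_add, mul_one]

theorem outputGate_lt_length_extractCircuit {i : ℕ} (hi : i < π.length) :
    outputGate i < (extractCircuit F π).length := by
  rw [length_extractCircuit, outputGate]
  omega

/-- Every line of `π` follows from the lines before it. -/
def IsDerivation (Q : Prefix) (φ : CNF) (π : Proof) : Prop :=
  ∀ (k : ℕ) (L : Line), π[k]? = some L → L.Follows Q φ (π.take k)

theorem isDerivation_append_singleton_iff :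
    IsDerivation Q φ (π ++ [L]) ↔ IsDerivation Q φ π ∧ L.Follows Q φ π := by
  rw [IsDerivation, forall_getElem?_append_singleton_iff, List.take_left, IsDerivation]
  refine and_congr_left' (forall₃_congr fun k L' hk => ?_)
  rw [List.take_append_of_le_length (List.getElem?_eq_some_iff.1 hk).1.le]

theorem IsDerivation.admissible_extractCircuit (hπ : IsDerivation Q φ π) :
    (extractCircuit F π).Admissible F.p := by
  induction π using List.reverseRecOn with
  | nil => exact Circuit.admissible_nil
  | append_singleton π L ih =>
    obtain ⟨hπ, hL⟩ := isDerivation_append_singleton_iff.1 hπ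
    obtain ⟨hs, ht, he⟩ := Inference.admissible_selection (F := F) fun i hi =>
      outputGate_lt_length_extractCircuit (F := F) (hL.premises_lt i hi)
    rw [extractCircuit_append_singleton]
    exact Circuit.admissible_append_selectGates (ih hπ) hs ht he

theorem IsDerivation.interpolates (hF : F.WellFormed) (hπ : IsDerivation F.quants F.matrix π) :
    ∀ k L, π[k]? = some L →
      Interpolates F a L.clause ((extractCircuit F π).gateValue a (outputGate k)) := by
  induction π using List.reverseRecOn with
  | nil => simp
  | append_singleton π L ih =>
    obtain ⟨hπ, hL⟩ := isDerivation_append_singleton_iff.1 hπ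
    rw [extractCircuit_append_singleton, forall_getElem?_append_singleton_iff]
    constructor
    · intro k P hP
      have hk := outputGate_lt_length_extractCircuit (F := F) (List.getElem?_eq_some_iff.1 hP).1
      rw [Circuit.gateValue_append_left hk]
      exact ih hπ k P hP
    · have hlength : outputGate π.length = (extractCircuit F π).length + 4 := by
        rw [outputGate, length_extractCircuit]
      rw [hlength, Inference.gateValue_append_gates fun i hi =>
        outputGate_lt_length_extractCircuit (hL.premises_lt i hi)]
      exact hL.interpolates hF (ih hπ)

theorem IsRefutation.isInterpolationCircuit (hF : F.WellFormed)
    (hπ : IsRefutation F.quants F.matrix π) :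
    IsInterpolationCircuit F (extractCircuit F π) := by
  obtain ⟨hπ : IsDerivation F.quants F.matrix π, L, hlast, hL⟩ := hπ
  have hpos : 0 < π.length :=
    List.length_pos_of_mem (List.mem_of_getLast? hlast)
  have hlength := length_extractCircuit (F := F) (π := π)
  have hinterp (a : ℕ → Bool) : Interpolates F a ∅ ((extractCircuit F π).eval a) := by
    have houtput : (extractCircuit F π).length - 1 = outputGate (π.length - 1) := by
      rw [hlength, outputGate]
      omega
    rw [List.getLast?_eq_getElem?] at hlast
    rw [← hL, Circuit.eval_eq_gateValue, houtput]
    exact hπ.interpolates hF _ L hlast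
  refine ⟨⟨?_, hπ.admissible_extractCircuit⟩, fun a => ?_⟩
  · exact List.ne_nil_of_length_pos (by omega)
  · exact ⟨fun h => (h ▸ hinterp a).not_qTrue hF, fun h => (h ▸ hinterp a).not_qTrue hF⟩

end Extraction

/-! ### Computability of the extraction -/

section Primrec

variable {α : Type*} [Primcodable α]

theorem SplitQBF.primrec_p : Primrec SplitQBF.p :=
  Primrec.fst.comp (Primrec.of_equiv (e := SplitQBF.equiv))

theorem SplitQBF.primrec_q : Primrec SplitQBF.q :=
  (Primrec.fst.comp Primrec.snd).comp (Primrec.of_equiv (e := SplitQBF.equiv))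

theorem SplitQBF.primrec_A : Primrec SplitQBF.A :=
  (Primrec.fst.comp (Primrec.snd.comp (Primrec.snd.comp Primrec.snd))).comp
    (Primrec.of_equiv (e := SplitQBF.equiv))

theorem Prefix.primrec_vars : Primrec Prefix.vars :=
  Primrec.list_map .id (Primrec.snd.comp Primrec.snd)

theorem Line.primrec_inference : Primrec Line.inference :=
  Primrec.snd.comp (Primrec.of_equiv (e := Line.equiv))

theorem Gate.primrec_const : Primrec Gate.const :=
  (Primrec.of_equiv_symm (e := Gate.equiv)).comp Primrec.sumInl

theorem Gate.primrec_input : Primrec Gate.input :=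
  (Primrec.of_equiv_symm (e := Gate.equiv)).comp (Primrec.sumInr.comp Primrec.sumInl)

theorem Gate.primrec_not : Primrec Gate.not :=
  (Primrec.of_equiv_symm (e := Gate.equiv)).comp
    (Primrec.sumInr.comp (Primrec.sumInr.comp Primrec.sumInl))

theorem Gate.primrec_and : Primrec₂ Gate.and :=
  (Primrec.of_equiv_symm (e := Gate.equiv)).comp
    (Primrec.sumInr.comp (Primrec.sumInr.comp (Primrec.sumInr.comp Primrec.sumInl)))

theorem Gate.primrec_or : Primrec₂ Gate.or :=
  (Primrec.of_equiv_symm (e := Gate.equiv)).comp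
    (Primrec.sumInr.comp (Primrec.sumInr.comp (Primrec.sumInr.comp Primrec.sumInr)))

theorem primrecPred_mem {β : Type*} [Primcodable β] {f : α → β} {l : α → List β}
    (hf : Primrec f) (hl : Primrec l) : PrimrecPred fun x => f x ∈ l x := by
  classical
  exact (Primrec.nat_lt.comp (Primrec.list_idxOf.comp hf hl) (Primrec.list_length.comp hl)).of_eq
    fun _ => List.idxOf_lt_length_iff

theorem primrec_outputGate : Primrec outputGate :=
  Primrec.nat_add.comp (Primrec.nat_mul.comp (Primrec.const 5) .id) (Primrec.const 4)

theorem Circuit.primrec_selectGates {n t e : α → ℕ} {s : α → Gate} (hn : Primrec n)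
    (hs : Primrec s) (ht : Primrec t) (he : Primrec e) :
    Primrec fun x => Circuit.selectGates (n x) (s x) (t x) (e x) := by
  have hadd (c : ℕ) : Primrec fun x => n x + c := Primrec.nat_add.comp hn (.const c)
  exact Primrec.list_cons.comp hs <|
    Primrec.list_cons.comp (Gate.primrec_not.comp hn) <|
    Primrec.list_cons.comp (Gate.primrec_and.comp hn ht) <|
    Primrec.list_cons.comp (Gate.primrec_and.comp (hadd 1) he) <|
    Primrec.list_cons.comp (Gate.primrec_or.comp (hadd 2) (hadd 3)) (.const [])

theorem Inference.primrec_casesOn {σ : Type*} [Primcodable σ] {I : α → Inference}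
    {ax : α → Clause → σ} {inst merge : α → ℕ → σ} {res : α → ℕ × ℕ × ℕ → σ} (hI : Primrec I)
    (hax : Primrec₂ ax) (hinst : Primrec₂ inst) (hres : Primrec₂ res) (hmerge : Primrec₂ merge) :
    Primrec fun x => (Inference.casesOn (I x) (ax x) (inst x) (fun i j y => res x (i, j, y))
      (merge x) : σ) := by
  have hequiv : Primrec fun x => Inference.equiv (I x) :=
    (Primrec.of_equiv (e := Inference.equiv)).comp hI
  refine (Primrec.sumCasesOn hequiv hax <| .to₂ <| Primrec.sumCasesOn .snd
    (hinst.comp (Primrec.fst.comp .fst) .snd).to₂ <| .to₂ <| Primrec.sumCasesOn .snd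
    (hres.comp (Primrec.fst.comp (Primrec.fst.comp .fst)) .snd).to₂
    (hmerge.comp (Primrec.fst.comp (Primrec.fst.comp .fst)) .snd).to₂).of_eq fun x => ?_
  cases I x <;> rfl

theorem Inference.primrec_selection {F : α → SplitQBF} {n : α → ℕ} {I : α → Inference}
    (hF : Primrec F) (hn : Primrec n) (hI : Primrec I) :
    Primrec fun x => (I x).selection (F x) (n x) := by
  have hax : Primrec₂ fun x C => (Gate.const !decide (C ∈ (F x).A), n x, n x) :=
    (Gate.primrec_const.comp (Primrec.not.comp
      (primrecPred_mem .snd (SplitQBF.primrec_A.comp (hF.comp .fst))).decide)).pair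
        ((hn.comp .fst).pair (hn.comp .fst))
  have hcopy : Primrec₂ fun (_ : α) i => (Gate.const true, outputGate i, outputGate i) :=
    have hout := primrec_outputGate.comp .snd
    (Primrec.const _).pair (hout.pair hout)
  have hres : Primrec₂ fun x (y : ℕ × ℕ × ℕ) =>
      if y.2.2 ∈ (F x).p then (Gate.input y.2.2, outputGate y.2.1, outputGate y.1)
      else if y.2.2 ∈ (F x).q.vars then (Gate.or (outputGate y.1) (outputGate y.2.1), n x, n x)
      else (Gate.and (outputGate y.1) (outputGate y.2.1), n x, n x) := by
    have hx : Primrec fun z : α × ℕ × ℕ × ℕ => z.2.2.2 :=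
      Primrec.snd.comp (Primrec.snd.comp .snd)
    have hi : Primrec fun z : α × ℕ × ℕ × ℕ => outputGate z.2.1 :=
      primrec_outputGate.comp (Primrec.fst.comp .snd)
    have hj : Primrec fun z : α × ℕ × ℕ × ℕ => outputGate z.2.2.1 :=
      primrec_outputGate.comp (Primrec.fst.comp (Primrec.snd.comp .snd))
    have hF' := hF.comp (Primrec.fst (β := ℕ × ℕ × ℕ))
    have hn' := hn.comp (Primrec.fst (β := ℕ × ℕ × ℕ))
    exact .ite (primrecPred_mem hx (SplitQBF.primrec_p.comp hF'))
      ((Gate.primrec_input.comp hx).pair (hj.pair hi)) <|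
      .ite (primrecPred_mem hx (Prefix.primrec_vars.comp (SplitQBF.primrec_q.comp hF')))
        ((Gate.primrec_or.comp hi hj).pair (hn'.pair hn'))
        ((Gate.primrec_and.comp hi hj).pair (hn'.pair hn'))
  refine (Inference.primrec_casesOn hI hax hcopy hres hcopy).of_eq fun x => ?_
  cases I x <;> rfl

theorem primrec_extractCircuit :
    Primrec fun z : SplitQBF × Proof => extractCircuit z.1 z.2 := by
  have hselection : Primrec fun y : (SplitQBF × Proof) × Circuit × Line =>
      y.2.2.inference.selection y.1.1 y.2.1.length :=
    Inference.primrec_selection (Primrec.fst.comp .fst)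
      (Primrec.list_length.comp (Primrec.fst.comp .snd))
      (Line.primrec_inference.comp (Primrec.snd.comp .snd))
  have hgates : Primrec fun y : (SplitQBF × Proof) × Circuit × Line =>
      y.2.2.inference.gates y.1.1 y.2.1.length :=
    Circuit.primrec_selectGates (Primrec.list_length.comp (Primrec.fst.comp .snd))
      (Primrec.fst.comp hselection) (Primrec.fst.comp (Primrec.snd.comp hselection))
      (Primrec.snd.comp (Primrec.snd.comp hselection))
  exact Primrec.list_foldl .snd (.const [])
    (Primrec.list_append.comp (Primrec.fst.comp .snd) hgates).to₂

end Primrec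

end IRMCalc

theorem theorem3p4 :
    ∃ (extract : IRMCalc.SplitQBF × IRMCalc.Proof → IRMCalc.Circuit) (P : Polynomial ℕ),
      Computable extract ∧
      ∀ (F : IRMCalc.SplitQBF) (π : IRMCalc.Proof), F.WellFormed →
        IRMCalc.IsRefutation F.quants F.matrix π →
          IRMCalc.IsInterpolationCircuit F (extract (F, π)) ∧
          (extract (F, π)).size ≤ P.eval π.size := by
  refine ⟨fun z => IRMCalc.extractCircuit z.1 z.2, 5 * Polynomial.X,
    IRMCalc.primrec_extractCircuit.to_comp, fun F π hF hπ => ⟨hπ.isInterpolationCircuit hF, ?_⟩⟩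
  simp [IRMCalc.Circuit.size, IRMCalc.Proof.size, IRMCalc.length_extractCircuit]
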